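/- Call a linear inequality in $n$ variables an expression $\sum_{S\subseteq\{1,\dots,n\}}\alpha_S\,\mathrm H(A_j:j\in S)\ge 0$ with real coefficients $\alpha_S$, where, for subspaces $A_1,\dots,A_n$ of a finite-dimensional vector space over a finite field, $\mathrm H(A_j:j\in S)=\dim\bigl(\sum_{j\in S}A_j\bigr)$. Such an inequality holds over characteristic $q$ if it is satisfied by all $n$-tuples of subspaces of all finite-dimensional vector spaces over all finite fields of characteristic $q$; it is a linear rank inequality if it holds over every prime characteristic. For $m\in\mathbb N$ and a prime $p$, let $\varphi(m,p)$ be the number of integers $k\ge 1$ with $p^k\le m$. Let $n\ge 7$ and let $p$ be a prime. Then there is a finite set $\mathcal S$ of at least $\varphi\!\left(\left\lfloor\frac{n-1}{2}\right\rfloor-2,\,p\right)$ linear inequalities in $n$ variables such that: 1. each inequality in $\mathcal S$ is characteristic-dependent: it holds over characteristic $p$ and does not hold over characteristic $q$ for any prime $q\ne p$; 2. the inequalities in $\mathcal S$ are independent: no inequality in $\mathcal S$ is a consequence of the other inequalities in $\mathcal S$ together with all linear rank inequalities in $n$ variables. That is, for each inequality in $\mathcal S$ there is an $n$-tuple of subspaces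 of a finite-dimensional vector space over a finite field that satisfies all the other inequalities in $\mathcal S$ and all linear rank inequalities in $n$ variables but violates the given one. -/

import Mathlib

/-- The linear inequality `∑ S, α S * H(A_j : j ∈ S) ≥ 0` in `n` variables, recorded by its real
coefficients, one for every subset `S` of the index set. -/
abbrev RankInequality (n : ℕ) := Finset (Fin n) → ℝ

/-- The entropy `H(A_j : j ∈ S) = dim (∑ j ∈ S, A_j)` of a tuple of subspaces. -/
noncomputable def linearEntropy {F V : Type} [Field F] [AddCommGroup V] [Module F V] {n : ℕ}
    (A : Fin n → Submodule F V) (S : Finset (Fin n)) : ℝ :=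
  (Module.finrank F (⨆ j ∈ S, A j : Submodule F V) : ℝ)

/-- The inequality `α` is satisfied by the tuple of subspaces `A`. -/
def RankInequality.HoldsAt {F V : Type} [Field F] [AddCommGroup V] [Module F V] {n : ℕ}
    (α : RankInequality n) (A : Fin n → Submodule F V) : Prop :=
  0 ≤ ∑ S : Finset (Fin n), α S * linearEntropy A S

/-- The inequality `α` holds for all tuples of subspaces of finite-dimensional vector spaces over
finite fields whose characteristic lies in `P`. -/
def RankInequality.HoldsOverChars {n : ℕ} (P : Set ℕ) (α : RankInequality n) : Prop :=
  ∀ (F V : Type) [Field F] [Finite F] [AddCommGroup V] [Module F V] [Module.Finite F V],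
    ringChar F ∈ P → ∀ A : Fin n → Submodule F V, α.HoldsAt A

/-- A linear rank inequality: one that holds over all finite fields. -/
def RankInequality.IsLinearRankInequality {n : ℕ} (α : RankInequality n) : Prop :=
  α.HoldsOverChars {q | q.Prime}

/-- The inequality `α` is a consequence of the set `T` of inequalities: every tuple of subspaces
(of a finite-dimensional vector space over a finite field) that satisfies all members of `T`
satisfies `α`. In particular every combination of members of `T` with nonnegative coefficients is
a consequence of `T`. -/
def RankInequality.IsConsequenceOf {n : ℕ} (α : RankInequality n) (T : Set (RankInequality n)) :
    Prop :=
  ∀ (F V : Type) [Field F] [Finite F] [AddCommGroup V] [Module F V] [Module.Finite F V]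
    (A : Fin n → Submodule F V), (∀ β ∈ T, RankInequality.HoldsAt β A) → α.HoldsAt A

/-- `φ(m, p)`: the number of powers `p, p², p³, …` of `p` that are at most `m`. -/
noncomputable def primePowerCount (m p : ℕ) : ℕ :=
  Set.ncard {x : ℕ | x ≤ m ∧ ∃ k : ℕ, 1 ≤ k ∧ x = p ^ k}

/-!
A single characteristic-dependent inequality suffices, because copies of it on overlapping sets of
variables are independent of each other.

Let `t = p + 1`. In `F ^ t` take the lines `Aᵢ = ⟨eᵢ⟩`, `Bᵢ = ⟨1 - eᵢ⟩` and `C = ⟨1⟩`. Since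
`∑ (1 - eᵢ) = (t - 1) • 1 = p • 1`, the `Bᵢ` are dependent in characteristic `p` and independent in
every other characteristic. The inequality `rankGap ≥ 0` is a robust form of this observation: for
arbitrary subspaces over a field of characteristic `p` it says that the `Bᵢ` satisfy about `dim C`
linear relations, with an error controlled by terms that vanish on the configuration above.

It is proved in `rankGap_nonneg_of_card_eq_one`. On a subspace of `C` of small codimension one can
write `c = aᵢ + bᵢ` linearly, with `aᵢ ∈ Aᵢ` and `bᵢ ∈ Bᵢ ∩ ∑_{j ≠ i} Aⱼ`. Up to the overlaps of
the `Aᵢ` with each other, the `aᵢ` are the components of `c` along the `Aᵢ`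
(`sum_mem_iSup_inf_iSup_ne`), so that `∑ bᵢ = t c - ∑ aᵢ = (t - 1) c = 0`, which is a relation
between elements of the `Bᵢ`. In any other characteristic the coordinate configuration violates the
inequality (`rankGap_coordinate_neg`). If `C = 0`, the inequality holds over every field
(`rankGap_bot_nonneg`).

Now fix `2 t` variables for the `Aᵢ` and `Bᵢ` and let `C` be any one of the remaining `n - 2 t`
variables; these are the inequalities of the required set. The coordinate configuration placed on
one of them, with all other variables zero, violates that inequality only, because each of the
others has `C = 0`. Finally, the powers of `p` that are at most `m` lie in `[p, m]`, and for
`m = ⌊(n - 1) / 2⌋ - 2` there are at most `n - 2 t` numbers in that interval when `p ≤ m`.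
-/

open Module

/-! ### The rank inequality -/

/-- The right-hand side minus the left-hand side of the rank inequality
`H(C) + H(B) ≤ ∑ H(Bᵢ) + ∑ H(C | Aᵢ, Bᵢ) + ∑ H(Bᵢ | Aⱼ : j ≠ i) + 2 ∑ I(Aᵢ ; Aⱼ : j ≠ i)`,
where `H(B)` is the rank of all the `Bᵢ` together. -/
noncomputable def rankGap {F V ι : Type} [Field F] [AddCommGroup V] [Module F V] [Fintype ι]
    (A B : ι → Submodule F V) (C : Submodule F V) : ℝ :=
  ∑ i, (finrank F (B i) : ℝ)
    + ∑ i, ((finrank F ↥(C ⊔ (A i ⊔ B i)) : ℝ) - finrank F ↥(A i ⊔ B i))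
    + ∑ i, ((finrank F ↥(B i ⊔ ⨆ (j) (_ : j ≠ i), A j) : ℝ)
        - finrank F ↥(⨆ (j) (_ : j ≠ i), A j))
    + 2 * ∑ i, ((finrank F (A i) : ℝ) + finrank F ↥(⨆ (j) (_ : j ≠ i), A j)
        - finrank F ↥(⨆ j, A j))
    - finrank F C - finrank F ↥(⨆ i, B i)

section LinearAlgebra

variable {F V ι : Type} [Field F] [AddCommGroup V] [Module F V]

theorem le_iSup_ne (A : ι → Submodule F V) {i j : ι} (h : j ≠ i) :
    A j ≤ ⨆ (k) (_ : k ≠ i), A k :=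
  le_iSup₂_of_le j h le_rfl

theorem sup_iSup_ne_eq_iSup (A : ι → Submodule F V) (i : ι) :
    A i ⊔ ⨆ (j) (_ : j ≠ i), A j = ⨆ j, A j := by
  apply le_antisymm
  · exact sup_le (le_iSup A i) (iSup_le fun j => iSup_le fun _ => le_iSup A j)
  · refine iSup_le fun j => ?_
    by_cases h : j = i
    · subst h; exact le_sup_left
    · exact le_sup_of_le_right (le_iSup_ne A h)

/-- If `c = aᵢ + bᵢ` with `aᵢ ∈ Aᵢ` and `bᵢ ∈ ∑_{j ≠ i} Aⱼ` for every `i`, then, up to the overlaps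
of the `Aᵢ`, the `aᵢ` are the components of `c`; so `∑ bᵢ` is `(|ι| - 1) c`, which vanishes when
`|ι| = 1` in the field. -/
theorem sum_mem_iSup_inf_iSup_ne [Fintype ι] (hcard : (Fintype.card ι : F) = 1) [Nonempty ι]
    (A : ι → Submodule F V) (c : V) (b : ι → V) (hb : ∀ i, b i ∈ ⨆ (j) (_ : j ≠ i), A j)
    (ha : ∀ i, c - b i ∈ A i) :
    ∑ i, b i ∈ ⨆ i, (A i ⊓ ⨆ (j) (_ : j ≠ i), A j) := by
  classical
  have hc : c ∈ ⨆ i, A i := by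
    let i : ι := Classical.arbitrary ι
    rw [← sup_iSup_ne_eq_iSup A i]
    exact Submodule.mem_sup.2 ⟨_, ha i, _, hb i, by simp⟩
  obtain ⟨x, hx⟩ := (Submodule.mem_iSup_iff_exists_finsupp A c).1 hc
  have hsum : ∑ i, x i = c := by
    rw [← hx.2, Finsupp.sum_fintype _ _ (fun _ => rfl)]
  have hd : ∀ i, x i - (c - b i) ∈ A i ⊓ ⨆ (j) (_ : j ≠ i), A j := by
    intro i
    refine ⟨sub_mem (hx.1 i) (ha i), ?_⟩
    have h1 : x i - (c - b i) = b i - ∑ j ∈ Finset.univ.erase i, x j := by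
      rw [← hsum, ← Finset.add_sum_erase _ _ (Finset.mem_univ i)]
      abel
    rw [h1]
    refine sub_mem (hb i) (sum_mem fun j hj => ?_)
    exact le_iSup_ne A (Finset.ne_of_mem_erase hj) (hx.1 j)
  have h2 : ∑ i, b i = ∑ i, (x i - (c - b i)) := by
    simp only [Finset.sum_sub_distrib, hsum, Finset.sum_const, Finset.card_univ]
    rw [← Nat.cast_smul_eq_nsmul F, hcard, one_smul]
    abel
  rw [h2]
  exact sum_mem fun i _ => Submodule.mem_iSup_of_mem i (hd i)

variable [Module.Finite F V]

theorem finrank_sup_add_finrank_inf_eq_real (P Q : Submodule F V) :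
    (finrank F ↥(P ⊔ Q) : ℝ) + finrank F ↥(P ⊓ Q) = finrank F P + finrank F Q := by
  exact_mod_cast Submodule.finrank_sup_add_finrank_inf_eq P Q

theorem finrank_mono_real {P Q : Submodule F V} (h : P ≤ Q) :
    (finrank F P : ℝ) ≤ finrank F Q := by
  exact_mod_cast Submodule.finrank_mono h

/-- The mutual information `I(Aᵢ ; Aⱼ : j ≠ i)` is the dimension of an intersection. -/
theorem finrank_inf_iSup_ne (A : ι → Submodule F V) (i : ι) :
    (finrank F ↥(A i ⊓ ⨆ (j) (_ : j ≠ i), A j) : ℝ) =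
      finrank F (A i) + finrank F ↥(⨆ (j) (_ : j ≠ i), A j) - finrank F ↥(⨆ j, A j) := by
  have := finrank_sup_add_finrank_inf_eq_real (A i) (⨆ (j) (_ : j ≠ i), A j)
  rw [sup_iSup_ne_eq_iSup] at this
  linarith

variable [Fintype ι]

/-- The space of linear relations `∑ bᵢ = 0` with `bᵢ ∈ Bᵢ`. -/
def relationSpace (B : ι → Submodule F V) : Submodule F ((i : ι) → B i) :=
  LinearMap.ker (∑ i, (B i).subtype ∘ₗ LinearMap.proj i)

theorem finrank_iSup_add_finrank_relationSpace_le (B : ι → Submodule F V) :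
    (finrank F ↥(⨆ i, B i) : ℝ) + finrank F (relationSpace B) ≤ ∑ i, (finrank F (B i) : ℝ) := by
  classical
  set f : ((i : ι) → B i) →ₗ[F] V := ∑ i, (B i).subtype ∘ₗ LinearMap.proj i with hf
  have h1 : (⨆ i, B i) ≤ LinearMap.range f := by
    refine iSup_le fun i x hx => ⟨Pi.single i ⟨x, hx⟩, ?_⟩
    rw [hf, LinearMap.sum_apply, Finset.sum_eq_single i]
    · simp
    · intro j _ hj
      simp [Pi.single_eq_of_ne hj]
    · simp
  have h2 := LinearMap.finrank_range_add_finrank_ker f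
  rw [Module.finrank_pi_fintype] at h2
  have h3 := Submodule.finrank_mono h1
  have h4 : finrank F (relationSpace B) = finrank F (LinearMap.ker f) := rfl
  rw [h4]
  exact_mod_cast h2 ▸ Nat.add_le_add_right h3 _

theorem finrank_iSup_le_sum (B : ι → Submodule F V) :
    (finrank F ↥(⨆ i, B i) : ℝ) ≤ ∑ i, (finrank F (B i) : ℝ) := by
  have := finrank_iSup_add_finrank_relationSpace_le B
  have h : (0 : ℝ) ≤ finrank F (relationSpace B) := Nat.cast_nonneg _
  linarith

/-- Cutting `C` down by subspaces `Uᵢ` costs at most the sum of the conditional ranks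
`H(C | Uᵢ)`. -/
theorem finrank_sub_finrank_inf_iInf_le (C : Submodule F V) (U : ι → Submodule F V) :
    (finrank F C : ℝ) - finrank F ↥(C ⊓ ⨅ i, U i) ≤
      ∑ i, ((finrank F ↥(C ⊔ U i) : ℝ) - finrank F (U i)) := by
  classical
  have key : ∀ s : Finset ι, (finrank F C : ℝ) - finrank F ↥(C ⊓ ⨅ i ∈ s, U i) ≤
      ∑ i ∈ s, ((finrank F ↥(C ⊔ U i) : ℝ) - finrank F (U i)) := by
    intro s
    induction s using Finset.induction_on with
    | empty =>
      have h : C ⊓ ⨅ i ∈ (∅ : Finset ι), U i = C := by simp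
      rw [h, sub_self, Finset.sum_empty]
    | insert i s hi ih =>
      rw [Finset.sum_insert hi, Finset.iInf_insert]
      have h1 := finrank_sup_add_finrank_inf_eq_real (C ⊓ ⨅ i ∈ s, U i) (U i)
      have h2 : (finrank F ↥((C ⊓ ⨅ i ∈ s, U i) ⊔ U i) : ℝ) ≤ finrank F ↥(C ⊔ U i) :=
        finrank_mono_real (sup_le_sup_right inf_le_left _)
      have h3 : C ⊓ (U i ⊓ ⨅ x ∈ s, U x) = (C ⊓ ⨅ i ∈ s, U i) ⊓ U i := by ac_rfl
      rw [h3]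
      linarith
  have h : C ⊓ ⨅ i ∈ Finset.univ, U i = C ⊓ ⨅ i, U i := by simp
  exact h ▸ key Finset.univ

/-- Splitting the elements of `P ≤ U ⊔ W` into a part in `W` and a part in `U` can be done
linearly. -/
theorem exists_linearMap_sub_mem {P U W : Submodule F V} (h : P ≤ U ⊔ W) :
    ∃ f : P →ₗ[F] V, ∀ c : P, f c ∈ W ∧ (c : V) - f c ∈ U := by
  let q : W →ₗ[F] V ⧸ U := U.mkQ ∘ₗ W.subtype
  obtain ⟨g, hg⟩ := q.rangeRestrict.exists_rightInverse_of_surjective q.range_rangeRestrict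
  have hP : ∀ c : P, U.mkQ c ∈ LinearMap.range q := by
    rintro ⟨c, hc⟩
    obtain ⟨u, hu, w, hw, rfl⟩ := Submodule.mem_sup.1 (h hc)
    refine ⟨⟨w, hw⟩, ?_⟩
    have : U.mkQ u = 0 := by simpa using hu
    simp only [q, LinearMap.comp_apply, Submodule.subtype_apply, map_add, this, zero_add]
  let r : P →ₗ[F] LinearMap.range q := (U.mkQ ∘ₗ P.subtype).codRestrict _ hP
  refine ⟨W.subtype ∘ₗ g ∘ₗ r, fun c => ⟨(g (r c)).2, ?_⟩⟩
  have h1 : q (g (r c)) = U.mkQ c := congrArg Subtype.val (LinearMap.congr_fun hg (r c))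
  have h2 : U.mkQ ((c : V) - (W.subtype ∘ₗ g ∘ₗ r) c) = 0 := by
    rw [map_sub, ← h1]
    exact sub_self _
  exact (Submodule.Quotient.mk_eq_zero U).1 h2

/-- The rank inequality holds when `|ι| = 1` in the field: every `c` in a
subspace of `C` of controlled codimension yields a relation between elements of the `Bᵢ`. -/
theorem rankGap_nonneg_of_card_eq_one [Nontrivial ι] (hcard : (Fintype.card ι : F) = 1)
    (A B : ι → Submodule F V) (C : Submodule F V) : 0 ≤ rankGap A B C := by
  obtain ⟨i₀, i₁, hne⟩ := exists_pair_ne ι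
  set O : ι → Submodule F V := fun i => ⨆ (j) (_ : j ≠ i), A j with hO
  set U : ι → Submodule F V := fun i => A i ⊔ (B i ⊓ O i) with hU
  set P : Submodule F V := C ⊓ ⨅ i, U i with hP
  have hPU : ∀ i, P ≤ A i ⊔ (B i ⊓ O i) := fun i => inf_le_right.trans (iInf_le U i)
  choose f hf using fun i => exists_linearMap_sub_mem (hPU i)
  -- the relation `∑ bᵢ = 0` holds on the kernel of `g`, whose codimension is at most that of
  -- the overlaps of the `Aᵢ`
  let g : P →ₗ[F] V := ∑ i, f i
  have hg : LinearMap.range g ≤ ⨆ i, (A i ⊓ O i) := by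
    rintro _ ⟨c, rfl⟩
    rw [LinearMap.sum_apply]
    exact sum_mem_iSup_inf_iSup_ne hcard A c (fun i => f i c) (fun i => (hf i c).1.2)
      fun i => (hf i c).2
  let φ : LinearMap.ker g →ₗ[F] relationSpace B :=
    LinearMap.codRestrict _
      (LinearMap.pi fun i => LinearMap.codRestrict (B i) (f i ∘ₗ (LinearMap.ker g).subtype)
        fun c => (hf i c).1.1)
      (by
        rintro ⟨c, hc⟩
        rw [relationSpace, LinearMap.mem_ker, LinearMap.sum_apply]
        rw [LinearMap.mem_ker, LinearMap.sum_apply] at hc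
        exact hc)
  -- an element with all `bᵢ = 0` lies in every `Aᵢ`
  have hφ : finrank F (LinearMap.ker φ) ≤ finrank F ↥(A i₀ ⊓ O i₀) := by
    let ψ : LinearMap.ker φ →ₗ[F] ↥(A i₀ ⊓ O i₀) :=
      LinearMap.codRestrict _
        (P.subtype ∘ₗ (LinearMap.ker g).subtype ∘ₗ (LinearMap.ker φ).subtype) (by
          rintro ⟨c, hc⟩
          have h0 : ∀ i, f i c = 0 := fun i =>
            congrArg (fun v : relationSpace B => ((v.1 i : B i) : V)) (LinearMap.mem_ker.1 hc)
          have h1 : ∀ i, ((c : P) : V) ∈ A i := fun i => by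
            simpa [h0 i] using (hf i c).2
          exact ⟨h1 i₀, le_iSup_ne A hne.symm (h1 i₁)⟩)
    refine LinearMap.finrank_le_finrank_of_injective (f := ψ) ?_
    intro x y hxy
    exact Subtype.ext (Subtype.ext (Subtype.ext (congrArg (fun v : ↥(A i₀ ⊓ O i₀) => (v : V)) hxy)))
  have e1 := finrank_iSup_add_finrank_relationSpace_le B
  have e2 : (finrank F (LinearMap.ker g) : ℝ) ≤
      finrank F (relationSpace B) + finrank F ↥(A i₀ ⊓ O i₀) := by
    have h1 := LinearMap.finrank_range_add_finrank_ker φ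
    have h2 := Submodule.finrank_le (LinearMap.range φ)
    exact_mod_cast (by omega : finrank F (LinearMap.ker g) ≤
      finrank F (relationSpace B) + finrank F ↥(A i₀ ⊓ O i₀))
  have e3 : (finrank F P : ℝ) ≤ finrank F (LinearMap.ker g) + ∑ i, (finrank F ↥(A i ⊓ O i) : ℝ) := by
    have h1 := LinearMap.finrank_range_add_finrank_ker g
    have h2 := (finrank_mono_real hg).trans (finrank_iSup_le_sum _)
    rw [← h1]
    push_cast
    linarith
  have e4 : (finrank F ↥(A i₀ ⊓ O i₀) : ℝ) ≤ ∑ i, (finrank F ↥(A i ⊓ O i) : ℝ) :=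
    Finset.single_le_sum (f := fun i => (finrank F ↥(A i ⊓ O i) : ℝ))
      (fun _ _ => Nat.cast_nonneg _) (Finset.mem_univ i₀)
  have e5 := finrank_sub_finrank_inf_iInf_le C U
  have e6 : ∑ i, ((finrank F ↥(C ⊔ U i) : ℝ) - finrank F (U i)) ≤
      ∑ i, ((finrank F ↥(C ⊔ (A i ⊔ B i)) : ℝ) - finrank F ↥(A i ⊔ B i)) +
      ∑ i, ((finrank F ↥(B i ⊔ O i) : ℝ) - finrank F (O i)) := by
    rw [← Finset.sum_add_distrib]
    refine Finset.sum_le_sum fun i _ => ?_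
    have h1 : (finrank F ↥(C ⊔ U i) : ℝ) ≤ finrank F ↥(C ⊔ (A i ⊔ B i)) :=
      finrank_mono_real (sup_le_sup_left (sup_le_sup_left inf_le_left _) _)
    have h2 := finrank_sup_add_finrank_inf_eq_real (B i) (O i)
    have h3 := finrank_sup_add_finrank_inf_eq_real (U i) (B i)
    have h4 : U i ⊔ B i = A i ⊔ B i := by
      rw [hU, sup_assoc, sup_eq_right.2 (inf_le_left : B i ⊓ O i ≤ B i)]
    have h5 : (finrank F ↥(B i ⊓ O i) : ℝ) ≤ finrank F ↥(U i ⊓ B i) :=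
      finrank_mono_real (le_inf le_sup_right inf_le_left)
    rw [h4] at h3
    linarith
  have e7 : ∑ i, (finrank F ↥(A i ⊓ O i) : ℝ) =
      ∑ i, ((finrank F (A i) : ℝ) + finrank F (O i) - finrank F ↥(⨆ j, A j)) :=
    Finset.sum_congr rfl fun i _ => finrank_inf_iSup_ne A i
  rw [rankGap]
  linarith

/-- When `C = 0` the rank inequality is a consequence of submodularity, over every field. -/
theorem rankGap_bot_nonneg (A B : ι → Submodule F V) : 0 ≤ rankGap A B ⊥ := by
  have h1 := finrank_iSup_le_sum B
  have h2 : 0 ≤ ∑ i, ((finrank F ↥(B i ⊔ ⨆ (j) (_ : j ≠ i), A j) : ℝ)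
        - finrank F ↥(⨆ (j) (_ : j ≠ i), A j)) :=
    Finset.sum_nonneg fun i _ => sub_nonneg.2 (finrank_mono_real le_sup_right)
  have h3 : 0 ≤ ∑ i, ((finrank F (A i) : ℝ) + finrank F ↥(⨆ (j) (_ : j ≠ i), A j)
        - finrank F ↥(⨆ j, A j)) :=
    Finset.sum_nonneg fun i _ => finrank_inf_iSup_ne A i ▸ Nat.cast_nonneg _
  have h4 : ∀ i, (finrank F ↥(⊥ ⊔ (A i ⊔ B i)) : ℝ) - finrank F ↥(A i ⊔ B i) = 0 := fun i => by
    rw [bot_sup_eq, sub_self]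
  simp only [rankGap, h4, Finset.sum_const_zero, finrank_bot, Nat.cast_zero]
  linarith

/-- The violating configuration: the coordinate lines, the lines of their complements `1 - eᵢ`, and
the line of the all-ones vector. The `1 - eᵢ` sum to `(|ι| - 1) • 1`, so they span everything. -/
theorem rankGap_coordinate_neg [DecidableEq ι] [Nonempty ι] (hcard : (Fintype.card ι : F) ≠ 1) :
    rankGap (fun i : ι => Submodule.span F {(Pi.single i 1 : ι → F)})
      (fun i => Submodule.span F {(1 - Pi.single i 1 : ι → F)})
      (Submodule.span F {(1 : ι → F)}) < 0 := by
  set A : ι → Submodule F (ι → F) := fun i => Submodule.span F {Pi.single i 1} with hA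
  set B : ι → Submodule F (ι → F) := fun i => Submodule.span F {1 - Pi.single i 1} with hB
  set C : Submodule F (ι → F) := Submodule.span F {1} with hC
  have hAm : ∀ i, (Pi.single i 1 : ι → F) ∈ A i := fun i => Submodule.mem_span_singleton_self _
  have hBm : ∀ i, (1 - Pi.single i 1 : ι → F) ∈ B i := fun i =>
    Submodule.mem_span_singleton_self _
  have hone : ∑ i, (Pi.single i 1 : ι → F) = 1 := Finset.univ_sum_single (1 : ι → F)
  have hAtop : ⨆ i, A i = ⊤ := by
    rw [eq_top_iff, ← (Pi.basisFun F ι).span_eq, Submodule.span_le]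
    rintro _ ⟨i, rfl⟩
    rw [Pi.basisFun_apply]
    exact Submodule.mem_iSup_of_mem i (hAm i)
  have hBtop : ⨆ i, B i = ⊤ := by
    have hsum : ∑ i, (1 - Pi.single i 1 : ι → F) = ((Fintype.card ι : F) - 1) • 1 := by
      rw [Finset.sum_sub_distrib, hone, Finset.sum_const, Finset.card_univ, sub_smul, one_smul,
        Nat.cast_smul_eq_nsmul]
    have h1 : (1 : ι → F) ∈ ⨆ i, B i := by
      have h2 : ((Fintype.card ι : F) - 1) • (1 : ι → F) ∈ ⨆ i, B i :=
        hsum ▸ sum_mem fun i _ => Submodule.mem_iSup_of_mem i (hBm i)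
      exact (Submodule.smul_mem_iff _ (sub_ne_zero.2 hcard)).1 h2
    rw [eq_top_iff, ← hAtop]
    refine iSup_le fun i => ?_
    rw [hA, Submodule.span_singleton_le_iff_mem]
    simpa using sub_mem h1 (Submodule.mem_iSup_of_mem i (hBm i))
  have htop : (finrank F ↥(⊤ : Submodule F (ι → F)) : ℝ) = Fintype.card ι := by
    rw [finrank_top, Module.finrank_fintype_fun_eq_card]
  have hA1 : ∀ i, (finrank F (A i) : ℝ) ≤ 1 := fun i => by
    exact_mod_cast (finrank_span_le_card (R := F) {(Pi.single i 1 : ι → F)}).trans (by simp)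
  have hB1 : ∀ i, (finrank F (B i) : ℝ) ≤ 1 := fun i => by
    exact_mod_cast (finrank_span_le_card (R := F) {(1 - Pi.single i 1 : ι → F)}).trans (by simp)
  have hC1 : (finrank F C : ℝ) = 1 := by
    exact_mod_cast finrank_span_singleton (K := F) (one_ne_zero : (1 : ι → F) ≠ 0)
  have hCA : ∀ i, (finrank F ↥(C ⊔ (A i ⊔ B i)) : ℝ) - finrank F ↥(A i ⊔ B i) = 0 := fun i => by
    suffices h : C ⊔ (A i ⊔ B i) = A i ⊔ B i by rw [h, sub_self]
    rw [sup_eq_right, hC, Submodule.span_singleton_le_iff_mem]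
    exact Submodule.mem_sup.2 ⟨_, hAm i, _, hBm i, by simp⟩
  have hBA : ∀ i, (finrank F ↥(B i ⊔ ⨆ (j) (_ : j ≠ i), A j) : ℝ)
      - finrank F ↥(⨆ (j) (_ : j ≠ i), A j) = 0 := fun i => by
    suffices h : B i ⊔ ⨆ (j) (_ : j ≠ i), A j = ⨆ (j) (_ : j ≠ i), A j by rw [h, sub_self]
    rw [sup_eq_right, hB, Submodule.span_singleton_le_iff_mem, ← hone,
      ← Finset.sum_erase_eq_sub (Finset.mem_univ i)]
    exact sum_mem fun j hj =>
      le_iSup_ne A (Finset.ne_of_mem_erase hj) (hAm j)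
  have hO : ∀ i, A i ⊓ ⨆ (j) (_ : j ≠ i), A j = ⊥ := fun i => by
    have hle : (⨆ (j) (_ : j ≠ i), A j) ≤
        LinearMap.ker (LinearMap.proj (R := F) (φ := fun _ => F) i) := by
      refine iSup₂_le fun j hj => ?_
      rw [hA, Submodule.span_singleton_le_iff_mem, LinearMap.mem_ker]
      simp [Pi.single_eq_of_ne hj.symm]
    rw [eq_bot_iff]
    rintro x ⟨hx1, hx2⟩
    obtain ⟨r, rfl⟩ := Submodule.mem_span_singleton.1 hx1
    have := hle hx2
    have hr : r = 0 := by simpa using this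
    simp [hr]
  have hI : ∀ i, (finrank F (A i) : ℝ) + finrank F ↥(⨆ (j) (_ : j ≠ i), A j)
        - finrank F ↥(⨆ j, A j) = 0 := fun i => by
    rw [← finrank_inf_iSup_ne, hO, finrank_bot, Nat.cast_zero]
  have hBsum : ∑ i, (finrank F (B i) : ℝ) ≤ Fintype.card ι := by
    simpa using Finset.sum_le_sum fun i (_ : i ∈ Finset.univ) => hB1 i
  rw [rankGap, hBtop, htop, hC1]
  simp only [hCA, hBA, hI, Finset.sum_const_zero]
  linarith

end LinearAlgebra

/-! ### The inequality in `n` variables -/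

/-- The coefficient vector of the single entropy `H(A_j : j ∈ S)`. -/
noncomputable def entropyTerm {n : ℕ} (S : Finset (Fin n)) : RankInequality n := Pi.single S 1

/-- The inequality `rankGap ≥ 0`, in which the variables `e (inl i)`, `e (inr i)` and `c` play the
roles of `Aᵢ`, `Bᵢ` and `C`. -/
noncomputable def gapInequality {ι : Type} [Fintype ι] [DecidableEq ι] {n : ℕ}
    (e : ι ⊕ ι → Fin n) (c : Fin n) : RankInequality n :=
  ∑ i, entropyTerm {e (Sum.inr i)}
    + ∑ i, (entropyTerm {c, e (Sum.inl i), e (Sum.inr i)}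
        - entropyTerm {e (Sum.inl i), e (Sum.inr i)})
    + ∑ i, (entropyTerm (insert (e (Sum.inr i)) ((Finset.univ.erase i).image (e ∘ Sum.inl)))
        - entropyTerm ((Finset.univ.erase i).image (e ∘ Sum.inl)))
    + (2 : ℝ) • ∑ i, (entropyTerm {e (Sum.inl i)}
        + entropyTerm ((Finset.univ.erase i).image (e ∘ Sum.inl))
        - entropyTerm (Finset.univ.image (e ∘ Sum.inl)))
    - entropyTerm {c} - entropyTerm (Finset.univ.image (e ∘ Sum.inr))

section Encoding

variable {F V ι : Type} [Field F] [AddCommGroup V] [Module F V] [Fintype ι] [DecidableEq ι] {n : ℕ}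

theorem entropyTerm_dotProduct (S : Finset (Fin n)) (h : Finset (Fin n) → ℝ) :
    entropyTerm S ⬝ᵥ h = h S :=
  single_one_dotProduct S h

theorem holdsAt_gapInequality_iff (e : ι ⊕ ι → Fin n) (c : Fin n) (A : Fin n → Submodule F V) :
    (gapInequality e c).HoldsAt A ↔
      0 ≤ rankGap (fun i => A (e (Sum.inl i))) (fun i => A (e (Sum.inr i))) (A c) := by
  have hent : ∀ {S : Finset (Fin n)} {W : Submodule F V}, (⨆ j ∈ S, A j) = W →
      linearEntropy A S = finrank F W := fun h => by rw [linearEntropy, h]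
  have h1 : ∀ x, linearEntropy A {x} = finrank F (A x) := fun x =>
    hent (Finset.iSup_singleton _ _)
  have h2 : ∀ x y, linearEntropy A {x, y} = finrank F ↥(A x ⊔ A y) := fun x y =>
    hent (by rw [Finset.iSup_insert, Finset.iSup_singleton])
  have h3 : ∀ x y z, linearEntropy A {x, y, z} = finrank F ↥(A x ⊔ (A y ⊔ A z)) := fun x y z =>
    hent (by rw [Finset.iSup_insert, Finset.iSup_insert, Finset.iSup_singleton])
  have hO : ∀ i, (⨆ j ∈ (Finset.univ.erase i).image (e ∘ Sum.inl), A j) =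
      ⨆ (j) (_ : j ≠ i), A (e (Sum.inl j)) := fun i => by
    rw [Finset.iSup_finset_image]
    simp
  have hOB : ∀ i x, linearEntropy A (insert x ((Finset.univ.erase i).image (e ∘ Sum.inl))) =
      finrank F ↥(A x ⊔ ⨆ (j) (_ : j ≠ i), A (e (Sum.inl j))) := fun i x =>
    hent (by rw [Finset.iSup_insert, hO])
  have hall : ∀ f : ι → Fin n,
      linearEntropy A (Finset.univ.image f) = finrank F ↥(⨆ j, A (f j)) := fun f =>
    hent (by rw [Finset.iSup_finset_image]; simp)
  change 0 ≤ gapInequality e c ⬝ᵥ linearEntropy A ↔ _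
  simp only [gapInequality, add_dotProduct, sub_dotProduct, sum_dotProduct, smul_dotProduct,
    entropyTerm_dotProduct, smul_eq_mul, rankGap, h1, h2, h3, hent (hO _), hOB, hall,
    Function.comp_apply]

theorem gapInequality_holdsOverChars {p : ℕ} [Nontrivial ι] (hcard : Fintype.card ι = p + 1)
    (e : ι ⊕ ι → Fin n) (c : Fin n) : (gapInequality e c).HoldsOverChars {p} := by
  intro F V _ _ _ _ _ hF A
  have hp : (p : F) = 0 := by
    rw [← Set.mem_singleton_iff.1 hF]
    exact ringChar.Nat.cast_ringChar
  rw [holdsAt_gapInequality_iff]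
  exact rankGap_nonneg_of_card_eq_one (by rw [hcard, Nat.cast_succ, hp, zero_add]) _ _ _

/-- The violating configuration, placed on the variables `e` and `c`; all other variables are the
zero subspace. -/
noncomputable def coordinateTuple (F : Type) [Field F] (e : ι ⊕ ι → Fin n) (c : Fin n) :
    Fin n → Submodule F (ι → F) :=
  Function.update
    (Function.extend e
      (Sum.elim (fun i => Submodule.span F {(Pi.single i 1 : ι → F)})
        fun i => Submodule.span F {(1 - Pi.single i 1 : ι → F)}) ⊥)
    c (Submodule.span F {(1 : ι → F)})

theorem not_holdsAt_coordinateTuple [Nonempty ι] (hcard : (Fintype.card ι : F) ≠ 1)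
    {e : ι ⊕ ι → Fin n} (he : Function.Injective e) {c : Fin n} (hc : c ∉ Set.range e) :
    ¬ (gapInequality e c).HoldsAt (coordinateTuple F e c) := by
  have h : ∀ x, coordinateTuple F e c (e x) = Sum.elim
      (fun i => Submodule.span F {(Pi.single i 1 : ι → F)})
      (fun i => Submodule.span F {(1 - Pi.single i 1 : ι → F)}) x := fun x => by
    rw [coordinateTuple, Function.update_of_ne (fun h => hc ⟨x, h⟩), he.extend_apply]
  have hc' : coordinateTuple F e c c = Submodule.span F {(1 : ι → F)} := Function.update_self ..
  rw [holdsAt_gapInequality_iff, not_le]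
  simp only [h, hc', Sum.elim_inl, Sum.elim_inr]
  exact rankGap_coordinate_neg hcard

theorem holdsAt_coordinateTuple_of_ne (e : ι ⊕ ι → Fin n) {c d : Fin n} (hd : d ∉ Set.range e)
    (hcd : d ≠ c) : (gapInequality e d).HoldsAt (coordinateTuple F e c) := by
  have h : coordinateTuple F e c d = ⊥ := by
    rw [coordinateTuple, Function.update_of_ne hcd, Function.extend_apply' _ _ _ hd]
    rfl
  rw [holdsAt_gapInequality_iff, h]
  exact rankGap_bot_nonneg _ _

end Encoding

/-! ### Counting and conclusion -/

theorem primePowerCount_le (m p : ℕ) : primePowerCount m p ≤ m + 1 - p := by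
  rw [primePowerCount, ← Nat.card_Icc, ← Set.ncard_coe_finset]
  refine Set.ncard_le_ncard ?_ (Finset.finite_toSet _)
  rintro x ⟨hx, k, hk, rfl⟩
  exact Finset.mem_coe.2 (Finset.mem_Icc.2 ⟨Nat.le_self_pow (by omega) p, hx⟩)

theorem mainTheorem5 (n p : ℕ) (hn : 7 ≤ n) (hp : p.Prime) :
    ∃ S : Finset (RankInequality n),
      primePowerCount ((n - 1) / 2 - 2) p ≤ S.card ∧
      (∀ α ∈ S, α.HoldsOverChars {p} ∧
        ∀ q : ℕ, q.Prime → q ≠ p → ¬ α.HoldsOverChars {q}) ∧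
      (∀ α ∈ S, ¬ α.IsConsequenceOf
        ({β | β ∈ S ∧ β ≠ α} ∪ {β | β.IsLinearRankInequality})) := by
  classical
  have hcount := primePowerCount_le ((n - 1) / 2 - 2) p
  have hp2 := hp.two_le
  -- for smaller `n` no power of `p` is counted
  by_cases hnp : n < 2 * p + 5
  · exact ⟨∅, by rw [Finset.card_empty]; omega, by simp, by simp⟩
  have : Nontrivial (Fin (p + 1)) := Fin.nontrivial_iff_two_le.2 (by omega)
  let e : Fin (p + 1) ⊕ Fin (p + 1) → Fin n :=
    Fin.castLE (by omega) ∘ finSumFinEquiv (m := p + 1) (n := p + 1)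
  have he : Function.Injective e := (Fin.castLE_injective _).comp finSumFinEquiv.injective
  have hcard : ∀ q : ℕ, q.Prime → q ≠ p → (Fintype.card (Fin (p + 1)) : ZMod q) ≠ 1 := by
    intro q hq hqp h
    rw [Fintype.card_fin, Nat.cast_succ, add_eq_right, ZMod.natCast_eq_zero_iff] at h
    exact hqp ((Nat.prime_dvd_prime_iff_eq hq hp).1 h)
  have hfail : ∀ c, c ∉ Set.range e → ∀ q : ℕ, q.Prime → q ≠ p → ∃ (_ : Fact q.Prime),
      ¬ (gapInequality e c).HoldsAt (coordinateTuple (ZMod q) e c) := fun c hc q hq hqp =>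
    have := Fact.mk hq
    ⟨this, not_holdsAt_coordinateTuple (hcard q hq hqp) he hc⟩
  -- one characteristic `q₀ ≠ p` serves for all the independence witnesses
  obtain ⟨q₀, hq₀p, hq₀⟩ : ∃ q, p + 1 ≤ q ∧ q.Prime := Nat.exists_infinite_primes (p + 1)
  have hq₀ne : q₀ ≠ p := by omega
  let T : Finset (Fin n) := (Finset.univ.image e)ᶜ
  have hT : ∀ {c}, c ∈ T → c ∉ Set.range e := by
    intro c hc
    simpa [T] using hc
  have hinj : Set.InjOn (gapInequality e) T := by
    intro c hc d hd hcd
    by_contra hne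
    obtain ⟨_, h⟩ := hfail c (hT hc) q₀ hq₀ hq₀ne
    exact h (hcd ▸ holdsAt_coordinateTuple_of_ne e (hT hd) (Ne.symm hne))
  refine ⟨T.image (gapInequality e), ?_, ?_, ?_⟩
  · rw [Finset.card_image_of_injOn hinj, Finset.card_compl, Finset.card_image_of_injective _ he,
      Finset.card_univ, Fintype.card_sum, Fintype.card_fin, Fintype.card_fin]
    omega
  · intro α hα
    obtain ⟨c, hc, rfl⟩ := Finset.mem_image.1 hα
    refine ⟨gapInequality_holdsOverChars (Fintype.card_fin _) e c, fun q hq hqp h => ?_⟩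
    obtain ⟨_, hq'⟩ := hfail c (hT hc) q hq hqp
    exact hq' (h (ZMod q) _ (ZMod.ringChar_zmod_n q) _)
  · intro α hα hcons
    obtain ⟨c, hc, rfl⟩ := Finset.mem_image.1 hα
    obtain ⟨_, h⟩ := hfail c (hT hc) q₀ hq₀ hq₀ne
    refine h (hcons (ZMod q₀) _ _ ?_)
    rintro β (⟨hβ, hne⟩ | hβ)
    · obtain ⟨d, hd, rfl⟩ := Finset.mem_image.1 hβ
      exact holdsAt_coordinateTuple_of_ne e (hT hd) fun hdc => hne (hdc ▸ rfl)
    · exact hβ (ZMod q₀) _ ((ZMod.ringChar_zmod_n q₀).symm ▸ hq₀) _
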